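/- Let $\mathcal H$ be a family of functions $\Lambda\to\{0,1\}$ on a finite set $\Lambda$, and let $\varepsilon\in(0,1)$. Write $\mathsf{sam}(\mathcal H,\varepsilon)$ for the least positive integer $m$ for which there is a randomized algorithm with the following property. For every probability distribution $\mu$ on $\Lambda$ and every $f:\Lambda\to\{0,1\}$, given $m$ labeled samples $(x_1,f(x_1)),\dots,(x_m,f(x_m))$ with $x_1,\dots,x_m$ drawn independently from $\mu$, the algorithm 1. accepts with probability at least $2/3$ if $f\in\mathcal H$; 2. rejects with probability at least $2/3$ if $\Pr_{x\sim\mu}[f(x)\neq g(x)]\ge\varepsilon$ for every $g\in\mathcal H$. For a positive integer $n$, let $\mathcal G^{\mathrm{cliq}}_n$ be the family of (indicator functions of) edge sets $E\subseteq\binom{[n]}{2}$ that form a clique, i.e. $E=\binom{S}{2}$ for some $S\subseteq[n]$ (so the empty edge set is included). **Theorem.** There are absolute constants $c,C>0$ such that for every positive integer $n$ and every $\varepsilon\in(0,\tfrac1{10})$ the number $\mathsf{sam}(\mathcal G^{\mathrm{cliq}}_n,\varepsilon)$ exists and $$c\,n^{2/3}\;\le\;\mathsf{sam}\big(\mathcal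 G^{\mathrm{cliq}}_n,\varepsilon\big)\;\le\;C\,\frac{n^{2/3}}{\varepsilon}.$$ -/

import Mathlib

/-- The domain `binom([n], 2)`: the two-element subsets of an `n`-element vertex set. -/
abbrev VertexPair (n : ℕ) : Type := {e : Finset (Fin n) // e.card = 2}

/-- A randomized decision procedure that sees `m` labeled samples (a point of the domain together
with its Boolean label). It maps the observed sequence to a probability distribution on the
answers, where `true` means accept and `false` means reject. -/
abbrev Tester (Λ : Type) (m : ℕ) : Type := (Fin m → Λ × Bool) → stdSimplex ℝ Bool

/-- The probability that the tester `A` answers `b` when it receives `m` independent `f`-labeled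
samples drawn from the probability mass function `μ`. -/
noncomputable def answerProb {Λ : Type} [Fintype Λ] {m : ℕ} (A : Tester Λ m)
    (μ : Λ → ℝ) (f : Λ → Bool) (b : Bool) : ℝ :=
  ∑ x : Fin m → Λ, (∏ i, μ (x i)) * (A fun i => (x i, f (x i))).1 b

/-- The probability, over `x` drawn from `μ`, that `f x ≠ g x`. -/
noncomputable def disagreement {Λ : Type} [Fintype Λ] (μ : Λ → ℝ) (f g : Λ → Bool) : ℝ :=
  ∑ x, if f x ≠ g x then μ x else 0

/-- `A` is a sample-based distribution-free tester (with two-sided error) for the property `H`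
with proximity parameter `ε`. -/
def IsTester {Λ : Type} [Fintype Λ] {m : ℕ} (A : Tester Λ m) (H : Set (Λ → Bool)) (ε : ℝ) :
    Prop :=
  ∀ μ ∈ stdSimplex ℝ Λ, ∀ f : Λ → Bool,
    (f ∈ H → 2 / 3 ≤ answerProb A μ f true) ∧
    ((∀ g ∈ H, ε ≤ disagreement μ f g) → 2 / 3 ≤ answerProb A μ f false)

/-- The positive numbers of samples that suffice to test `H` with proximity parameter `ε`. -/
def sufficientSampleSizes {Λ : Type} [Fintype Λ] (H : Set (Λ → Bool)) (ε : ℝ) : Set ℕ :=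
  {m | 0 < m ∧ ∃ A : Tester Λ m, IsTester A H ε}

/-- The sample complexity of distribution-free testing of `H`. -/
noncomputable def sam {Λ : Type} [Fintype Λ] (H : Set (Λ → Bool)) (ε : ℝ) : ℕ :=
  sInf (sufficientSampleSizes H ε)

/-- The (indicator functions of the) edge sets on `n` vertices that are cliques: all pairs inside
some vertex set `S`. Sets `S` with at most one element give the empty edge set. -/
def cliqueProperty (n : ℕ) : Set (VertexPair n → Bool) :=
  {f | ∃ S : Finset (Fin n), ∀ e : VertexPair n, f e = true ↔ e.1 ⊆ S}

/-! Lower bound. Take about `n / 6` disjoint blocks of six vertices, each carrying four labeled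
pairs, and sample these pairs uniformly. In `farPattern` a negative pair joins two positive pairs,
so every block contributes an error against every clique. In `cliquePattern` the same labels come
from a genuine clique. Inside one block, two sampled pairs never distinguish the patterns once the
vertices are randomly permuted: `recouple` matches the samples of one family with those of the
other, and `exists_perm_recouple` realizes the match by a vertex permutation. A tester can therefore
succeed only if some block is hit three times, which has probability at most `m ^ 3 / k ^ 2` for `k`
blocks; this gives `sq_le_of_isTester`.

Upper bound. The tester rejects when it sees a negative pair with both endpoints covered by positive
pairs, which is impossible for a clique. If `f` is far from cliques, a maximal fractional matching
`y` of the negative pairs, with degree at each vertex bounded by the positive degree, has mass at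
least `ε / 2` (`exists_matching_of_far`). Discarding vertices of small degree leaves a set `W` with
all `y`-degrees at least `δ`, of order `ε / n`. Samples then make progress in three stages: positive
pairs touch vertices of `W` until the touched `y`-degree exceeds `a`; negative pairs link them to
vertices of positive degree more than `b` in total; one positive pair at a linked vertex completes a
violation. With `a` of order `ε / n^(1/3)` and `b` of order `ε / n^(2/3)`, each stage takes at most
order `n^(2/3) / ε` samples in expectation. A potential function combines the stages
(`DominatedMatching.potential_step`), and `miss_prob_le` converts expected progress into a bound on
the failure probability. -/

open Finset

/-! ### Basic facts on answer probabilities -/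

section Sampling

variable {Λ T : Type} [Fintype Λ] {m : ℕ}

theorem sum_prod_eq_one {μ : Λ → ℝ} (hμ : μ ∈ stdSimplex ℝ Λ) :
    ∑ x : Fin m → Λ, ∏ i, μ (x i) = 1 := by
  classical
  have := Finset.prod_univ_sum (fun _ : Fin m => (Finset.univ : Finset Λ)) (fun _ x => μ x)
  rw [Fintype.piFinset_univ] at this
  rw [← this]
  simp [hμ.2]

theorem answerProb_add_answerProb (A : Tester Λ m) {μ : Λ → ℝ} (hμ : μ ∈ stdSimplex ℝ Λ)
    (f : Λ → Bool) : answerProb A μ f true + answerProb A μ f false = 1 := by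
  unfold answerProb
  rw [← Finset.sum_add_distrib, ← sum_prod_eq_one (m := m) hμ]
  refine Finset.sum_congr rfl fun x _ => ?_
  have h := (A fun i => (x i, f (x i))).2.2
  rw [Fintype.sum_bool] at h
  rw [← mul_add, h, mul_one]

/-- The image under `h` of the uniform distribution on `T`. -/
noncomputable def uniformImage [Fintype T] (h : T → Λ) : Λ → ℝ := by
  classical
  exact fun e => ∑ t, if h t = e then (Fintype.card T : ℝ)⁻¹ else 0

theorem uniformImage_mem [Fintype T] [Nonempty T] (h : T → Λ) :
    uniformImage h ∈ stdSimplex ℝ Λ := by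
  classical
  constructor
  · intro e
    exact Finset.sum_nonneg fun t _ => by split_ifs <;> positivity
  · unfold uniformImage
    rw [Finset.sum_comm]
    simp

/-- Turns answer probabilities into counts over index sequences `t`, on which the two hard families
can be compared by bijections. -/
theorem answerProb_uniformImage [Fintype T] (A : Tester Λ m) (h : T → Λ) (f : Λ → Bool)
    (b : Bool) :
    answerProb A (uniformImage h) f b =
      ((Fintype.card T : ℝ)⁻¹) ^ m *
        ∑ t : Fin m → T, (A fun i => (h (t i), f (h (t i)))).1 b := by
  classical
  unfold answerProb uniformImage
  have key : ∀ x : Fin m → Λ, (∏ i, ∑ t, if h t = x i then (Fintype.card T : ℝ)⁻¹ else 0) =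
      ∑ t : Fin m → T, if (fun i => h (t i)) = x then ((Fintype.card T : ℝ)⁻¹) ^ m else 0 := by
    intro x
    rw [Finset.prod_univ_sum, Fintype.piFinset_univ]
    refine Finset.sum_congr rfl fun t _ => ?_
    split_ifs with hx
    · subst hx; simp
    · obtain ⟨i, hi⟩ := Function.ne_iff.1 hx
      exact Finset.prod_eq_zero (Finset.mem_univ i) (if_neg hi)
  simp_rw [key, Finset.sum_mul]
  rw [Finset.sum_comm, Finset.mul_sum]
  refine Finset.sum_congr rfl fun t _ => ?_
  rw [Finset.sum_eq_single (fun i => h (t i))]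
  · simp
  · intro x _ hx; rw [if_neg hx.symm, zero_mul]
  · simp

theorem disagreement_uniformImage [Fintype T] (h : T → Λ) (f g : Λ → Bool) :
    disagreement (uniformImage h) f g =
      (Fintype.card T : ℝ)⁻¹ * #{t | f (h t) ≠ g (h t)} := by
  classical
  unfold disagreement uniformImage
  have : ∀ e, (if f e ≠ g e then ∑ t, (if h t = e then (Fintype.card T : ℝ)⁻¹ else 0) else 0) =
      ∑ t, if h t = e then (if f e ≠ g e then (Fintype.card T : ℝ)⁻¹ else 0) else 0 := by
    intro e; split_ifs <;> simp
  simp_rw [this]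
  rw [Finset.sum_comm]
  simp only [Finset.sum_ite_eq, Finset.mem_univ, if_true]
  rw [← Finset.sum_filter, Finset.sum_const, nsmul_eq_mul, mul_comm]

end Sampling

/-! ### Triple collisions -/

/-- Some block contains three of the points of `t`. -/
def HasTripleCollision {B S : Type} {m : ℕ} (t : Fin m → B × S) : Prop :=
  ∃ i j l, i ≠ j ∧ i ≠ l ∧ j ≠ l ∧ (t i).1 = (t j).1 ∧ (t i).1 = (t l).1

/-- Split by the common block `b`: the indicator becomes a product over coordinates, and each of the
three coordinates costs a factor `1 / card B`. -/
theorem card_collision {B S : Type} [Fintype B] [Fintype S] [DecidableEq B] [Nonempty B]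
    [Nonempty S] {m : ℕ} {i j l : Fin m} (hij : i ≠ j) (hil : i ≠ l) (hjl : j ≠ l) :
    (#{t : Fin m → B × S | (t i).1 = (t j).1 ∧ (t i).1 = (t l).1} : ℝ) =
      (Fintype.card (B × S) : ℝ) ^ m / (Fintype.card B : ℝ) ^ 2 := by
  classical
  have hB : (Fintype.card B : ℝ) ≠ 0 := by positivity
  have hS : (Fintype.card S : ℝ) ≠ 0 := by positivity
  have key : ∀ t : Fin m → B × S,
      (if (t i).1 = (t j).1 ∧ (t i).1 = (t l).1 then (1 : ℝ) else 0) =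
      ∑ b : B, ∏ s, if s ∈ ({i, j, l} : Finset (Fin m)) then
        (if (t s).1 = b then (1 : ℝ) else 0) else 1 := by
    intro t
    have : ∀ b : B, (∏ s, if s ∈ ({i, j, l} : Finset (Fin m)) then
        (if (t s).1 = b then (1 : ℝ) else 0) else 1) =
        if (t i).1 = b then
          (if (t i).1 = (t j).1 ∧ (t i).1 = (t l).1 then (1 : ℝ) else 0) else 0 := by
      intro b
      rw [Finset.prod_ite_mem, Finset.univ_inter, Finset.prod_insert (by simp [hij, hil]),
        Finset.prod_insert (by simp [hjl]), Finset.prod_singleton]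
      by_cases h : (t i).1 = b
      · subst h
        by_cases h1 : (t i).1 = (t j).1 <;> by_cases h2 : (t i).1 = (t l).1 <;>
          simp [h1, h2, eq_comm]
      · simp [h]
    simp_rw [this]
    simp
  rw [← Finset.sum_boole]
  simp_rw [key]
  rw [Finset.sum_comm]
  have h2 : ∀ b : B, (∑ t : Fin m → B × S, ∏ s, if s ∈ ({i, j, l} : Finset (Fin m)) then
        (if (t s).1 = b then (1 : ℝ) else 0) else 1) =
      (Fintype.card (B × S) : ℝ) ^ m / (Fintype.card B : ℝ) ^ 3 := by
    intro b
    have := Finset.prod_univ_sum (fun _ : Fin m => (Finset.univ : Finset (B × S)))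
      (fun s x => if s ∈ ({i, j, l} : Finset (Fin m)) then
        (if x.1 = b then (1 : ℝ) else 0) else 1)
    rw [Fintype.piFinset_univ] at this
    rw [← this]
    have h3 : ∀ s : Fin m, (∑ x : B × S, if s ∈ ({i, j, l} : Finset (Fin m)) then
        (if x.1 = b then (1 : ℝ) else 0) else 1) = (Fintype.card (B × S) : ℝ) *
        (if s ∈ ({i, j, l} : Finset (Fin m)) then (Fintype.card B : ℝ)⁻¹ else 1) := by
      intro s
      split_ifs
      · rw [Fintype.sum_prod_type_right]
        simp
        field_simp
      · simp
    simp_rw [h3]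
    rw [Finset.prod_mul_distrib, Finset.prod_ite_mem, Finset.univ_inter, Finset.prod_const,
      Finset.prod_const, Finset.card_eq_three.2 ⟨i, j, l, hij, hil, hjl, rfl⟩]
    simp
    field_simp
  simp_rw [h2]
  simp
  field_simp

-- Union bound over at most `m ^ 3` ordered triples of sample indices.
open Classical in
theorem card_tripleCollision_le {B S : Type} [Fintype B] [Fintype S] [Nonempty B]
    [Nonempty S] {m : ℕ} :
    (#{t : Fin m → B × S | HasTripleCollision t} : ℝ) ≤
      (m : ℝ) ^ 3 * ((Fintype.card (B × S) : ℝ) ^ m / (Fintype.card B : ℝ) ^ 2) := by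
  let P : Finset (Fin m × Fin m × Fin m) := {p | p.1 ≠ p.2.1 ∧ p.1 ≠ p.2.2 ∧ p.2.1 ≠ p.2.2}
  have hsub : ({t : Fin m → B × S | HasTripleCollision t} : Finset _) ⊆
      P.biUnion fun p => {t | (t p.1).1 = (t p.2.1).1 ∧ (t p.1).1 = (t p.2.2).1} := by
    intro t ht
    obtain ⟨i, j, l, h1, h2, h3, h⟩ := (Finset.mem_filter.1 ht).2
    exact Finset.mem_biUnion.2 ⟨(i, j, l), by simp [P, h1, h2, h3], by simpa using h⟩
  calc (#{t : Fin m → B × S | HasTripleCollision t} : ℝ)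
      ≤ ∑ p ∈ P, (#{t : Fin m → B × S |
          (t p.1).1 = (t p.2.1).1 ∧ (t p.1).1 = (t p.2.2).1} : ℝ) := by
        exact_mod_cast (Finset.card_le_card hsub).trans Finset.card_biUnion_le
    _ = ∑ p ∈ P, (Fintype.card (B × S) : ℝ) ^ m / (Fintype.card B : ℝ) ^ 2 := by
        refine Finset.sum_congr rfl fun p hp => ?_
        obtain ⟨h1, h2, h3⟩ := (Finset.mem_filter.1 hp).2
        exact card_collision h1 h2 h3
    _ ≤ _ := by
        rw [Finset.sum_const, nsmul_eq_mul]
        gcongr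
        have : #P ≤ m ^ 3 := (Finset.card_le_univ P).trans (by simp [pow_succ, mul_assoc])
        exact_mod_cast this

/-! ### The two families of hard instances -/

section HardInstances

variable {n k : ℕ}

/-- The action of a vertex permutation on pairs. -/
def mapPair (π : Equiv.Perm (Fin n)) (e : VertexPair n) : VertexPair n :=
  ⟨e.1.map π.toEmbedding, by rw [Finset.card_map, e.2]⟩

/-- The embedding of `k` disjoint blocks of six vertices. -/
def blockEmb (h : k * 6 ≤ n) : Fin k × Fin 6 ↪ Fin n :=
  finProdFinEquiv.toEmbedding.trans (Fin.castLEEmb h)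

/-- The copy in block `t.1` of the local pair `v t.2`. -/
def blockPair (ι : Fin k × Fin 6 ↪ Fin n) (v : Fin 4 → VertexPair 6) (t : Fin k × Fin 4) :
    VertexPair n :=
  ⟨((v t.2).1.map (Function.Embedding.sectR t.1 (Fin 6))).map ι, by
    rw [Finset.card_map, Finset.card_map, (v t.2).2]⟩

/-- A path of three pairs together with a disjoint pair. -/
def farPattern : Fin 4 → VertexPair 6 :=
  ![⟨{0, 1}, rfl⟩, ⟨{1, 2}, rfl⟩, ⟨{2, 3}, rfl⟩, ⟨{4, 5}, rfl⟩]

/-- Two disjoint paths of two pairs each. -/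
def cliquePattern : Fin 4 → VertexPair 6 :=
  ![⟨{0, 1}, rfl⟩, ⟨{1, 2}, rfl⟩, ⟨{3, 4}, rfl⟩, ⟨{4, 5}, rfl⟩]

/-- The labels of the four pairs of either pattern. -/
def patternLabel : Fin 4 → Bool := ![true, false, true, false]

/-- The permutation exchanging the two negative pairs of a pattern. -/
def swapNeg : Equiv.Perm (Fin 4) := Equiv.swap 1 3

theorem patternLabel_swapNeg (s : Fin 4) : patternLabel (swapNeg s) = patternLabel s := by
  revert s; decide

theorem mem_map_blockPair {ι : Fin k × Fin 6 ↪ Fin n} {v : Fin 4 → VertexPair 6}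
    {π : Equiv.Perm (Fin n)} {t : Fin k × Fin 4} {x : Fin n} :
    x ∈ (mapPair π (blockPair ι v t)).1 ↔ ∃ j ∈ (v t.2).1, π (ι (t.1, j)) = x := by
  simp [mapPair, blockPair, Equiv.eq_symm_apply]

theorem map_blockPair_subset {ι : Fin k × Fin 6 ↪ Fin n} {v : Fin 4 → VertexPair 6}
    {π : Equiv.Perm (Fin n)} {t : Fin k × Fin 4} {S : Finset (Fin n)} :
    (mapPair π (blockPair ι v t)).1 ⊆ S ↔ ∀ j ∈ (v t.2).1, π (ι (t.1, j)) ∈ S := by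
  simp only [Finset.subset_iff, mem_map_blockPair]
  grind

/-- The vertices of the clique in a `cliquePattern` instance. -/
def cliqueVertices (ι : Fin k × Fin 6 ↪ Fin n) (π : Equiv.Perm (Fin n)) : Finset (Fin n) :=
  ((Finset.univ ×ˢ {0, 1, 3, 4}).map ι).map π.toEmbedding

theorem mem_cliqueVertices {ι : Fin k × Fin 6 ↪ Fin n} {π : Equiv.Perm (Fin n)}
    {b : Fin k} {j : Fin 6} :
    π (ι (b, j)) ∈ cliqueVertices ι π ↔ j ∈ ({0, 1, 3, 4} : Finset (Fin 6)) := by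
  simp [cliqueVertices]

/-- The clique instance. -/
def cliqueInstance (ι : Fin k × Fin 6 ↪ Fin n) (π : Equiv.Perm (Fin n)) : VertexPair n → Bool :=
  fun e => decide (e.1 ⊆ cliqueVertices ι π)

theorem cliqueInstance_mem (ι : Fin k × Fin 6 ↪ Fin n) (π : Equiv.Perm (Fin n)) :
    cliqueInstance ι π ∈ cliqueProperty n :=
  ⟨cliqueVertices ι π, fun e => by simp [cliqueInstance]⟩

theorem cliqueInstance_apply (ι : Fin k × Fin 6 ↪ Fin n) (π : Equiv.Perm (Fin n))
    (t : Fin k × Fin 4) :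
    cliqueInstance ι π (mapPair π (blockPair ι cliquePattern t)) = patternLabel t.2 := by
  have h : ∀ s, decide (∀ j ∈ (cliquePattern s).1, j ∈ ({0, 1, 3, 4} : Finset (Fin 6))) =
      patternLabel s := by decide
  rw [← h, cliqueInstance]
  simp only [map_blockPair_subset, mem_cliqueVertices]

/-- The instance far from cliques. -/
def farInstance (ι : Fin k × Fin 6 ↪ Fin n) (π : Equiv.Perm (Fin n)) : VertexPair n → Bool :=
  fun e => decide (∃ t, patternLabel t.2 = true ∧ mapPair π (blockPair ι farPattern t) = e)

/-- Guarantees that the labels of `farInstance` on the sampled pairs are not in conflict. -/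
theorem map_blockPair_farPattern_injective (ι : Fin k × Fin 6 ↪ Fin n)
    (π : Equiv.Perm (Fin n)) :
    Function.Injective fun t => mapPair π (blockPair ι farPattern t) := by
  rintro ⟨b, s⟩ ⟨c, r⟩ h
  have hmem : ∀ x, x ∈ (mapPair π (blockPair ι farPattern (b, s))).1 ↔
      x ∈ (mapPair π (blockPair ι farPattern (c, r))).1 := fun x => by simp only at h; rw [h]
  simp only [mem_map_blockPair] at hmem
  have hloc : ∀ j ∈ (farPattern s).1, b = c ∧ j ∈ (farPattern r).1 := by
    intro j hj
    obtain ⟨j', hj', e⟩ := (hmem _).1 ⟨j, hj, rfl⟩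
    have := ι.injective (π.injective e)
    simp only [Prod.mk.injEq] at this
    exact ⟨this.1.symm, this.2 ▸ hj'⟩
  have h1 : ∀ s r, (farPattern s).1 ⊆ (farPattern r).1 → s = r := by decide
  obtain ⟨j, hj⟩ : ∃ j, j ∈ (farPattern s).1 := by
    have : ∀ s, ∃ j, j ∈ (farPattern s).1 := by decide
    exact this s
  rw [(hloc j hj).1, h1 s r fun j hj => (hloc j hj).2]

theorem farInstance_apply (ι : Fin k × Fin 6 ↪ Fin n) (π : Equiv.Perm (Fin n))
    (t : Fin k × Fin 4) :
    farInstance ι π (mapPair π (blockPair ι farPattern t)) = patternLabel t.2 := by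
  rw [farInstance, Bool.eq_iff_iff, decide_eq_true_iff]
  constructor
  · rintro ⟨t', ht', h⟩
    rwa [← map_blockPair_farPattern_injective ι π h]
  · exact fun h => ⟨t, h, rfl⟩

theorem farInstance_far (hk : 0 < k) (ι : Fin k × Fin 6 ↪ Fin n) (π : Equiv.Perm (Fin n))
    {g : VertexPair n → Bool} (hg : g ∈ cliqueProperty n) :
    1 / 4 ≤ disagreement (uniformImage fun t => mapPair π (blockPair ι farPattern t))
      (farInstance ι π) g := by
  classical
  obtain ⟨S, hS⟩ := hg
  rw [disagreement_uniformImage]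
  have hcard : k ≤ #{t : Fin k × Fin 4 | farInstance ι π (mapPair π (blockPair ι farPattern t)) ≠
      g (mapPair π (blockPair ι farPattern t))} := by
    -- A clique containing pairs `0` and `2` contains all vertices of the path, hence also the
    -- negative pair `1`.
    have hex : ∀ b : Fin k, ∃ s : Fin 4, patternLabel s ≠
        g (mapPair π (blockPair ι farPattern (b, s))) := by
      intro b
      by_contra! hb
      have h0 := (hS _).1 ((hb 0).symm.trans rfl)
      have h2 := (hS _).1 ((hb 2).symm.trans rfl)
      have h1 : ¬ _ := fun h => Bool.false_ne_true ((hb 1).trans ((hS _).2 h))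
      rw [map_blockPair_subset] at h0 h1 h2
      refine h1 fun j hj => ?_
      have : ∀ j ∈ (farPattern 1).1, j ∈ (farPattern 0).1 ∨ j ∈ (farPattern 2).1 := by decide
      exact (this j hj).elim (h0 j) (h2 j)
    choose s hs using hex
    calc k = #(Finset.univ.image fun b : Fin k => (b, s b)) := by
          rw [Finset.card_image_of_injective _ fun a b h => congrArg Prod.fst h]; simp
      _ ≤ _ := Finset.card_le_card fun t ht => by
          obtain ⟨b, -, rfl⟩ := Finset.mem_image.1 ht
          simpa [farInstance_apply] using hs b
  have hk' : (0 : ℝ) < k := by exact_mod_cast hk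
  have hcard' := (Nat.cast_le (α := ℝ)).2 hcard
  rw [Fintype.card_prod, Fintype.card_fin, Fintype.card_fin, inv_mul_eq_div,
    le_div_iff₀ (by positivity)]
  push_cast at *
  linarith

/-! ### Coupling the two families -/

/-- In the blocks where the pair of type `2` is sampled, exchange the two negative types. -/
def recouple {m : ℕ} (t : Fin m → Fin k × Fin 4) : Fin m → Fin k × Fin 4 :=
  fun i => ((t i).1, if ∃ j, t j = ((t i).1, 2) then swapNeg (t i).2 else (t i).2)

/-- The exchange is triggered by occurrences of type `2`, which `swapNeg` fixes, so the same blocks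
are exchanged again. Being a bijection, `recouple` preserves the uniform distribution of samples. -/
theorem recouple_involutive {m : ℕ} :
    Function.Involutive (recouple : (Fin m → Fin k × Fin 4) → _) := by
  intro t
  have h : ∀ b : Fin k, (∃ j, recouple t j = (b, 2)) ↔ ∃ j, t j = (b, 2) := by
    have h2 : ∀ s, swapNeg s = 2 ↔ s = 2 := by decide
    intro b
    refine exists_congr fun j => ?_
    unfold recouple
    split_ifs <;> simp [Prod.ext_iff, h2]
  funext i
  have h3 : ∀ s, swapNeg (swapNeg s) = s := by decide
  unfold recouple at h ⊢
  simp only [h]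
  split_ifs <;> simp [h3]

theorem patternLabel_recouple {m : ℕ} (t : Fin m → Fin k × Fin 4) (i : Fin m) :
    patternLabel (recouple t i).2 = patternLabel (t i).2 := by
  unfold recouple
  dsimp only
  split_ifs
  · exact patternLabel_swapNeg _
  · rfl

/-- In the far pattern the negative pair `1` meets both positive pairs; in the clique pattern it
meets only pair `0`, while `3` meets only `2`. Exchanging `1` and `3` when `2` is seen restores the
incidences unless `0`, `1` and `2` all occur. -/
theorem exists_local_perm (q : Finset (Fin 4)) (hq : 2 ∈ q → #q ≤ 2) :
    ∃ τ : Equiv.Perm (Fin 6), ∀ s ∈ q,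
      (cliquePattern (if 2 ∈ q then swapNeg s else s)).1.map τ.toEmbedding = (farPattern s).1 := by
  by_cases h2 : 2 ∈ q
  · simp only [h2, if_true]
    by_cases h0 : 0 ∈ q
    -- The size bound forces `q = {0, 2}`, and it suffices to move `{3, 4}` to `{2, 3}`.
    · refine ⟨Equiv.swap 2 4, fun s hs => ?_⟩
      have hs' : s = 0 ∨ s = 2 := by
        by_contra! hne
        have : #({0, 2, s} : Finset (Fin 4)) ≤ #q := Finset.card_le_card (by
          intro x hx
          simp only [Finset.mem_insert, Finset.mem_singleton] at hx
          rcases hx with rfl | rfl | rfl <;> assumption)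
        rw [Finset.card_eq_three.2 ⟨0, 2, s, by decide, hne.1.symm, hne.2.symm, rfl⟩] at this
        have := hq h2
        omega
      rcases hs' with rfl | rfl <;> decide
    · refine ⟨Equiv.swap 2 4 * Equiv.swap 1 5, fun s hs => ?_⟩
      have : s ≠ 0 := fun h => h0 (h ▸ hs)
      revert this
      clear hs
      revert s
      decide
  · simp only [h2, if_false]
    refine ⟨1, fun s hs => ?_⟩
    have : s ≠ 2 := fun h => h2 (h ▸ hs)
    revert this
    clear hs
    revert s
    decide

/-- Without a triple collision at most two types occur per block, so the local permutations exist;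
the blocks being disjoint, they glue together. -/
theorem exists_perm_recouple {m : ℕ} (ι : Fin k × Fin 6 ↪ Fin n) (t : Fin m → Fin k × Fin 4)
    (ht : ¬ HasTripleCollision t) :
    ∃ ρ : Equiv.Perm (Fin n), ∀ i,
      mapPair ρ (blockPair ι cliquePattern (recouple t i)) = blockPair ι farPattern (t i) := by
  classical
  have hloc : ∀ b : Fin k, ∃ τ : Equiv.Perm (Fin 6), ∀ i, (t i).1 = b →
      (cliquePattern (recouple t i).2).1.map τ.toEmbedding = (farPattern (t i).2).1 := by
    intro b
    let q : Finset (Fin 4) := {s | ∃ i, t i = (b, s)}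
    obtain ⟨τ, hτ⟩ := exists_local_perm q fun _ => by
      by_contra! hq
      obtain ⟨s₁, s₂, s₃, h1, h2, h3, h12, h13, h23⟩ := Finset.two_lt_card_iff.1 hq
      simp only [q, Finset.mem_filter, Finset.mem_univ, true_and] at h1 h2 h3
      obtain ⟨i, hi⟩ := h1
      obtain ⟨j, hj⟩ := h2
      obtain ⟨l, hl⟩ := h3
      refine ht ⟨i, j, l, ?_, ?_, ?_, by rw [hi, hj], by rw [hi, hl]⟩ <;> rintro rfl <;> simp_all
    refine ⟨τ, fun i hi => ?_⟩
    subst hi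
    have := hτ (t i).2 (by simp only [q, Finset.mem_filter, Finset.mem_univ, true_and]
                           exact ⟨i, rfl⟩)
    simpa [q, recouple] using this
  choose τ hτ using hloc
  refine ⟨Equiv.Perm.viaEmbedding (Equiv.prodCongrRight τ) ι, fun i => ?_⟩
  apply Subtype.ext
  have h := hτ _ i rfl
  unfold mapPair blockPair
  dsimp only
  rw [← h]
  ext x
  simp only [Finset.mem_map, Equiv.coe_toEmbedding, Function.Embedding.sectR_apply]
  simp [recouple, Equiv.Perm.viaEmbedding_apply]

/-- Averaged over vertex permutations, the rejection probabilities on the two families differ by at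
least `2/3 - 1/3`, but by at most the probability of a triple collision. -/
theorem sq_le_of_isTester {m : ℕ} (hk : 0 < k) (h : k * 6 ≤ n)
    {A : Tester (VertexPair n) m} {ε : ℝ} (hε : ε ≤ 1 / 4)
    (hA : IsTester A (cliqueProperty n) ε) : (k : ℝ) ^ 2 ≤ 3 * (m : ℝ) ^ 3 := by
  classical
  have : NeZero k := ⟨hk.ne'⟩
  let ι := blockEmb h
  let N : ℝ := (Fintype.card (Fin k × Fin 4) : ℝ)
  have hN : 0 < N := by positivity
  let a : (Fin m → VertexPair n) → (Fin m → Fin k × Fin 4) → ℝ := fun e t =>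
    (A fun i => (e i, patternLabel (t i).2)).1 false
  have ha0 : ∀ e t, 0 ≤ a e t := fun e t => (A _).2.1 false
  have ha1 : ∀ e t, a e t ≤ 1 := fun e t => by
    have h := (A fun i => (e i, patternLabel (t i).2)).2
    have h2 := h.2
    rw [Fintype.sum_bool] at h2
    have := h.1 true
    simp only [a]; linarith
  let F : Equiv.Perm (Fin n) → (Fin m → Fin k × Fin 4) → ℝ := fun π t =>
    a (fun i => mapPair π (blockPair ι farPattern (t i))) t
  let G : Equiv.Perm (Fin n) → (Fin m → Fin k × Fin 4) → ℝ := fun π t =>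
    a (fun i => mapPair π (blockPair ι cliquePattern (t i))) t
  have hF : ∀ π, 2 / 3 ≤ (N⁻¹) ^ m * ∑ t, F π t := by
    intro π
    have h1 := (hA _ (uniformImage_mem fun t => mapPair π (blockPair ι farPattern t))
      (farInstance ι π)).2 fun g hg => hε.trans (farInstance_far hk ι π hg)
    rw [answerProb_uniformImage] at h1
    simpa only [farInstance_apply] using h1
  have hG : ∀ π, (N⁻¹) ^ m * ∑ t, G π t ≤ 1 / 3 := by
    intro π
    have hμ := uniformImage_mem fun t => mapPair π (blockPair ι cliquePattern t)
    have h1 := (hA _ hμ (cliqueInstance ι π)).1 (cliqueInstance_mem ι π)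
    have h2 := answerProb_add_answerProb A hμ (cliqueInstance ι π)
    have h3 : answerProb A
        (uniformImage fun t => mapPair π (blockPair ι cliquePattern t))
        (cliqueInstance ι π) false = (N⁻¹) ^ m * ∑ t, G π t := by
      rw [answerProb_uniformImage]
      simp only [cliqueInstance_apply]
      rfl
    linarith
  let P : ℝ := Fintype.card (Equiv.Perm (Fin n))
  have hP : 0 < P := by positivity
  have hG' : ∀ π, ∑ t, G π t = ∑ t, G π (recouple t) := fun π =>
    (Equiv.sum_comp recouple_involutive.toPerm (G π)).symm
  have hdiff : ∀ t, ∑ π, (F π t - G π (recouple t)) ≤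
      if HasTripleCollision t then P else 0 := by
    intro t
    split_ifs with ht
    · calc _ ≤ ∑ π : Equiv.Perm (Fin n), (1 : ℝ) :=
            Finset.sum_le_sum fun π _ => by
              have := ha1 (fun i => mapPair π (blockPair ι farPattern (t i))) t
              have := ha0 (fun i => mapPair π (blockPair ι cliquePattern (recouple t i)))
                (recouple t)
              simp only [F, G]; linarith
        _ = P := by simp [P]
    · obtain ⟨ρ, hρ⟩ := exists_perm_recouple ι t ht
      have : ∀ π, F π t = G (π * ρ) (recouple t) := by
        intro π
        simp only [F, G, a, patternLabel_recouple]
        have hi : ∀ i, mapPair π (blockPair ι farPattern (t i)) =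
            mapPair (π * ρ) (blockPair ι cliquePattern (recouple t i)) := by
          intro i
          rw [← hρ i]
          apply Subtype.ext
          simp only [mapPair, Finset.map_map]
          rfl
        simp only [hi]
      rw [Finset.sum_sub_distrib]
      simp_rw [this]
      -- Averaging over all `π` absorbs `ρ`, although `ρ` depends on `t`.
      exact (sub_eq_zero.2
        (Equiv.sum_comp (Equiv.mulRight ρ) fun π => G π (recouple t))).le
  have hsum : P * (1 / 3) ≤ (N⁻¹) ^ m * ∑ t, ∑ π, (F π t - G π (recouple t)) := by
    rw [Finset.sum_comm, Finset.mul_sum]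
    calc P * (1 / 3) = ∑ π : Equiv.Perm (Fin n), (1 / 3 : ℝ) := by simp [P]
      _ ≤ _ := Finset.sum_le_sum fun π _ => by
        rw [Finset.sum_sub_distrib, ← hG', mul_sub]
        linarith [hF π, hG π]
  have hbad : ∑ t, ∑ π, (F π t - G π (recouple t)) ≤
      P * ((m : ℝ) ^ 3 * (N ^ m / (k : ℝ) ^ 2)) := by
    refine (Finset.sum_le_sum fun t _ => hdiff t).trans ?_
    rw [← Finset.sum_filter, Finset.sum_const, nsmul_eq_mul, mul_comm]
    have := card_tripleCollision_le (B := Fin k) (S := Fin 4) (m := m)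
    rw [Fintype.card_fin] at this
    exact mul_le_mul_of_nonneg_left this hP.le
  have hk' : (0 : ℝ) < k := by exact_mod_cast hk
  have h1 : P * (1 / 3) ≤ P * ((m : ℝ) ^ 3 / (k : ℝ) ^ 2) := by
    refine hsum.trans ((mul_le_mul_of_nonneg_left hbad (by positivity)).trans_eq ?_)
    rw [inv_pow]
    field_simp
  have h2 := le_of_mul_le_mul_left h1 hP
  rw [le_div_iff₀ (by positivity)] at h2
  linarith

theorem rpow_le_of_isTester {m : ℕ} (hn : 1 ≤ n) (hm : 0 < m) {A : Tester (VertexPair n) m} {ε : ℝ}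
    (hε : ε ≤ 1 / 4) (hA : IsTester A (cliqueProperty n) ε) :
    (1 / 10 : ℝ) * (n : ℝ) ^ ((2 : ℝ) / 3) ≤ m := by
  have hm' : (1 : ℝ) ≤ m := by exact_mod_cast hm
  have hn2 : (n : ℝ) ^ 2 ≤ 1000 * (m : ℝ) ^ 3 := by
    rcases lt_or_ge n 6 with h | h
    · have h6 : (n : ℝ) ≤ 6 := by exact_mod_cast h.le
      have : (1 : ℝ) ≤ (m : ℝ) ^ 3 := one_le_pow₀ hm'
      nlinarith [(Nat.cast_nonneg n : (0 : ℝ) ≤ n)]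
    -- Rounding down costs at most a factor two, and `144 * 3 ≤ 1000 = 10 ^ 3`.
    · have h1 := sq_le_of_isTester (k := n / 6) (by omega) (by omega) hε hA
      have h2 : n ≤ 12 * (n / 6) := by omega
      have h3 : (n : ℝ) ≤ 12 * ((n / 6 : ℕ) : ℝ) := by exact_mod_cast h2
      have h4 : (n : ℝ) ^ 2 ≤ (12 * ((n / 6 : ℕ) : ℝ)) ^ 2 := by gcongr
      have : (0 : ℝ) ≤ (m : ℝ) ^ 3 := by positivity
      nlinarith
  have h3 : ((n : ℝ) ^ ((2 : ℝ) / 3)) ^ 3 = (n : ℝ) ^ 2 := by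
    rw [← Real.rpow_natCast, ← Real.rpow_mul (Nat.cast_nonneg n)]
    norm_num
  have : ((n : ℝ) ^ ((2 : ℝ) / 3)) ≤ 10 * m := by
    refine le_of_pow_le_pow_left₀ (n := 3) (by norm_num) (by positivity) ?_
    rw [h3, mul_pow]; linarith
  linarith

end HardInstances

/-! ### A hitting time bound by expected progress -/

section Progress

variable {Λ : Type} [Fintype Λ]

/-- Until `R` becomes good, the potential gains at least `1` per sample in expectation, and it never
exceeds `K`. The induction conditions on the first sample; the extra copy of the miss probability is
bounded by `1` and paid for by that gain. -/
theorem miss_prob_le [DecidableEq Λ] {μ : Λ → ℝ} (hμ : μ ∈ stdSimplex ℝ Λ) {good : Finset Λ → Prop}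
    [DecidablePred good]
    (hgood : ∀ R R', R ⊆ R' → good R → good R') {φ : Finset Λ → ℝ} {K : ℝ}
    (hK : ∀ R, φ R ≤ K)
    (hstep : ∀ R, ¬ good R → φ R + 1 ≤ ∑ x, μ x * φ (insert x R)) (m : ℕ) (R : Finset Λ) :
    m * ∑ x : Fin m → Λ, (∏ i, μ (x i)) * (if good (R ∪ univ.image x) then 0 else 1) ≤
      K - φ R := by
  induction m generalizing R with
  | zero => simpa using hK R
  | succ m ih =>
    by_cases hR : good R
    · have : ∀ x : Fin (m + 1) → Λ, good (R ∪ univ.image x) := fun x =>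
        hgood _ _ Finset.subset_union_left hR
      simp only [this, if_true, mul_zero, Finset.sum_const_zero]
      linarith [hK R]
    · set F : Finset Λ → ℝ := fun R =>
        ∑ x : Fin m → Λ, (∏ i, μ (x i)) * (if good (R ∪ univ.image x) then 0 else 1) with hF
      have hle : ∑ x : Fin (m + 1) → Λ, (∏ i, μ (x i)) *
          (if good (R ∪ univ.image x) then (0 : ℝ) else 1) ≤ 1 := by
        refine le_trans ?_ (sum_prod_eq_one (m := m + 1) hμ).le
        refine Finset.sum_le_sum fun x _ => ?_
        have : 0 ≤ ∏ i, μ (x i) := Finset.prod_nonneg fun i _ => hμ.1 _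
        split_ifs <;> linarith
      have hrec : ∑ x : Fin (m + 1) → Λ, (∏ i, μ (x i)) *
          (if good (R ∪ univ.image x) then (0 : ℝ) else 1) = ∑ a, μ a * F (insert a R) := by
        rw [← (Fin.consEquiv fun _ => Λ).sum_comp, Fintype.sum_prod_type]
        refine Finset.sum_congr rfl fun a _ => ?_
        rw [hF, Finset.mul_sum]
        refine Finset.sum_congr rfl fun x _ => ?_
        have himg : R ∪ univ.image (Fin.cons a x : Fin (m + 1) → Λ) =
            insert a R ∪ univ.image x := by
          ext z
          simp [Fin.exists_fin_succ]
          tauto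
        change (∏ i, μ ((Fin.cons a x : Fin (m + 1) → Λ) i)) *
          (if good (R ∪ univ.image (Fin.cons a x : Fin (m + 1) → Λ)) then (0 : ℝ) else 1) = _
        simp only [himg]
        rw [Fin.prod_univ_succ]
        simp
      have h1 : m * ∑ a, μ a * F (insert a R) ≤ K - (φ R + 1) := by
        calc m * ∑ a, μ a * F (insert a R) = ∑ a, μ a * (m * F (insert a R)) := by
              rw [Finset.mul_sum]; exact Finset.sum_congr rfl fun a _ => by ring
          _ ≤ ∑ a, μ a * (K - φ (insert a R)) := Finset.sum_le_sum fun a _ =>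
              mul_le_mul_of_nonneg_left (ih _) (hμ.1 a)
          _ = K - ∑ a, μ a * φ (insert a R) := by
              simp_rw [mul_sub]
              rw [Finset.sum_sub_distrib, ← Finset.sum_mul, hμ.2, one_mul]
          _ ≤ _ := by linarith [hstep R hR]
      push_cast
      rw [add_mul, one_mul]
      rw [← hrec] at h1
      linarith

theorem add_one_le_sum_insert [DecidableEq Λ] {μ : Λ → ℝ} (hμ : μ ∈ stdSimplex ℝ Λ)
    {φ : Finset Λ → ℝ} (hφ : ∀ R R', R ⊆ R' → φ R ≤ φ R') {R : Finset Λ} {G : Finset Λ} {η p : ℝ}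
    (hη : 0 ≤ η) (hηp : 1 ≤ η * p) (hp : p ≤ ∑ x ∈ G, μ x)
    (hG : ∀ x ∈ G, φ R + η ≤ φ (insert x R)) :
    φ R + 1 ≤ ∑ x, μ x * φ (insert x R) := by
  calc φ R + 1 ≤ φ R + η * ∑ x ∈ G, μ x := by
        linarith [mul_le_mul_of_nonneg_left hp hη]
    _ = ∑ x, μ x * (φ R + if x ∈ G then η else 0) := by
        simp_rw [mul_add]
        rw [Finset.sum_add_distrib, ← Finset.sum_mul, hμ.2, one_mul, Finset.mul_sum]
        simp [mul_comm]
    _ ≤ _ := Finset.sum_le_sum fun x _ => mul_le_mul_of_nonneg_left (by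
        split_ifs with h
        · exact hG x h
        · simpa using hφ _ _ (Finset.subset_insert x R)) (hμ.1 x)

end Progress

/-! ### Weighted degrees and fractional matchings -/

section Matching

variable {n : ℕ}

/-- The total weight of the pairs at the vertex `u`. -/
def pairDeg (w : VertexPair n → ℝ) (u : Fin n) : ℝ := ∑ e, if u ∈ e.1 then w e else 0

/-- The part of `μ` on the pairs labeled `true`. -/
def trueWeight (μ : VertexPair n → ℝ) (f : VertexPair n → Bool) (e : VertexPair n) : ℝ :=
  if f e then μ e else 0

/-- The part of `μ` on the pairs labeled `false`. -/
def falseWeight (μ : VertexPair n → ℝ) (f : VertexPair n → Bool) (e : VertexPair n) : ℝ :=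
  if f e then 0 else μ e

theorem pairDeg_nonneg {w : VertexPair n → ℝ} (hw : ∀ e, 0 ≤ w e) (u : Fin n) :
    0 ≤ pairDeg w u :=
  Finset.sum_nonneg fun e _ => by split_ifs; exacts [hw e, le_rfl]

theorem sum_pairDeg (w : VertexPair n → ℝ) (X : Finset (Fin n)) :
    ∑ u ∈ X, pairDeg w u = ∑ e, w e * #(e.1 ∩ X) := by
  unfold pairDeg
  rw [Finset.sum_comm]
  refine Finset.sum_congr rfl fun e _ => ?_
  rw [← Finset.sum_filter, Finset.sum_const, nsmul_eq_mul, mul_comm, Finset.filter_mem_eq_inter,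
    Finset.inter_comm]

theorem card_inter_le_two (e : VertexPair n) (X : Finset (Fin n)) : (#(e.1 ∩ X) : ℝ) ≤ 2 := by
  exact_mod_cast (Finset.card_le_card Finset.inter_subset_left).trans_eq e.2

theorem sum_pairDeg_le {w : VertexPair n → ℝ} (hw : ∀ e, 0 ≤ w e) {X : Finset (Fin n)}
    {G : Finset (VertexPair n)} (hG : ∀ e, w e ≠ 0 → ∀ u ∈ e.1, u ∈ X → e ∈ G) :
    ∑ u ∈ X, pairDeg w u ≤ 2 * ∑ e ∈ G, w e := by
  rw [sum_pairDeg, Finset.mul_sum, ← Finset.sum_filter_add_sum_filter_not univ (· ∈ G)]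
  have h0 : ∑ e with e ∉ G, w e * (#(e.1 ∩ X) : ℝ) = 0 := by
    refine Finset.sum_eq_zero fun e he => ?_
    by_cases hwe : w e = 0
    · rw [hwe, zero_mul]
    · have : e.1 ∩ X = ∅ := Finset.eq_empty_of_forall_notMem fun u hu =>
        (Finset.mem_filter.1 he).2 (hG e hwe u (Finset.mem_inter.1 hu).1 (Finset.mem_inter.1 hu).2)
      rw [this]; simp
  rw [h0, add_zero, Finset.filter_mem_eq_inter, Finset.univ_inter]
  exact Finset.sum_le_sum fun e _ => by
    nlinarith [hw e, card_inter_le_two e X]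

/-- Greedy: treat the pairs one by one, raising each until its own capacity or that of an endpoint
is exhausted. Degrees only grow, so tight vertices stay tight. -/
theorem exists_maximal_matching {w₀ : VertexPair n → ℝ} {d : Fin n → ℝ} (hw₀ : ∀ e, 0 ≤ w₀ e)
    (hd : ∀ u, 0 ≤ d u) :
    ∃ y : VertexPair n → ℝ, (∀ e, 0 ≤ y e) ∧ (∀ e, y e ≤ w₀ e) ∧ (∀ u, pairDeg y u ≤ d u) ∧
      ∀ e, y e = w₀ e ∨ ∃ u ∈ e.1, pairDeg y u = d u := by
  classical
  suffices h : ∀ s : Finset (VertexPair n), ∃ y : VertexPair n → ℝ,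
      (∀ e, 0 ≤ y e) ∧ (∀ e, y e ≤ w₀ e) ∧ (∀ u, pairDeg y u ≤ d u) ∧
      ∀ e ∈ s, y e = w₀ e ∨ ∃ u ∈ e.1, pairDeg y u = d u by
    obtain ⟨y, h1, h2, h3, h4⟩ := h univ
    exact ⟨y, h1, h2, h3, fun e => h4 e (Finset.mem_univ e)⟩
  intro s
  induction s using Finset.induction_on with
  | empty => exact ⟨0, by simp, by simpa using hw₀, by simpa [pairDeg] using hd, by simp⟩
  | insert a s _ ih =>
    obtain ⟨y, h1, h2, h3, h4⟩ := ih
    have hne : a.1.Nonempty := Finset.card_pos.1 (by rw [a.2]; norm_num)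
    obtain ⟨u₀, hu₀, hmin⟩ := a.1.exists_min_image (fun u => d u - pairDeg y u) hne
    set η := min (w₀ a - y a) (d u₀ - pairDeg y u₀) with hη
    have hη0 : 0 ≤ η := le_min (by linarith [h2 a]) (by linarith [h3 u₀])
    have hηw : η ≤ w₀ a - y a := min_le_left _ _
    have hηd : η ≤ d u₀ - pairDeg y u₀ := min_le_right _ _
    let y' : VertexPair n → ℝ := fun e => y e + if e = a then η else 0
    have hdeg : ∀ u, pairDeg y' u = pairDeg y u + if u ∈ a.1 then η else 0 := by
      intro u
      unfold pairDeg
      have : ∀ e : VertexPair n, (if u ∈ e.1 then y' e else 0) = (if u ∈ e.1 then y e else 0) +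
          if e = a then (if u ∈ a.1 then η else 0) else 0 := by
        intro e
        by_cases he : e = a
        · subst he; by_cases hu : u ∈ e.1 <;> simp [y', hu]
        · simp [y', he]
      simp_rw [this]
      rw [Finset.sum_add_distrib]
      simp
    have h3' : ∀ u, pairDeg y' u ≤ d u := by
      intro u
      rw [hdeg]
      split_ifs with hu
      · linarith [hmin u hu]
      · simpa using h3 u
    refine ⟨y', fun e => ?_, fun e => ?_, h3', fun e he => ?_⟩
    · simp only [y']; split_ifs <;> linarith [h1 e]
    · simp only [y']; split_ifs with hea
      · subst hea; linarith
      · simpa using h2 e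
    · by_cases hea : e = a
      · subst hea
        rcases min_choice (w₀ e - y e) (d u₀ - pairDeg y u₀) with h | h
        · left; simp only [y', if_true]; linarith
        · right; refine ⟨u₀, hu₀, ?_⟩; rw [hdeg, if_pos hu₀]; linarith
      · rcases h4 e (Finset.mem_of_mem_insert_of_ne he hea) with h | ⟨u, hu, h⟩
        · left; simpa [y', hea] using h
        · right; refine ⟨u, hu, le_antisymm (h3' u) ?_⟩
          rw [hdeg, ← h]; split_ifs <;> linarith

/-- Compare `f` with the clique on the complement of the set `X` of tight vertices. Positive errors
meet `X`, where the positive degree equals the `y`-degree; negative errors avoid `X`, so maximality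
gives `y e = μ e` there. Together they weigh at most twice the mass of `y`. -/
theorem exists_matching_of_far {μ : VertexPair n → ℝ} (hμ : ∀ e, 0 ≤ μ e)
    {f : VertexPair n → Bool} {ε : ℝ}
    (hf : ∀ g ∈ cliqueProperty n, ε ≤ disagreement μ f g) :
    ∃ y : VertexPair n → ℝ, (∀ e, 0 ≤ y e) ∧ (∀ e, y e ≤ falseWeight μ f e) ∧
      (∀ u, pairDeg y u ≤ pairDeg (trueWeight μ f) u) ∧ ε / 2 ≤ ∑ e, y e := by
  classical
  have hneg : ∀ e, 0 ≤ falseWeight μ f e := fun e => by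
    unfold falseWeight; split_ifs; exacts [le_rfl, hμ e]
  have hpos : ∀ e, 0 ≤ trueWeight μ f e := fun e => by
    unfold trueWeight; split_ifs; exacts [hμ e, le_rfl]
  obtain ⟨y, h1, h2, h3, h4⟩ := exists_maximal_matching hneg (pairDeg_nonneg hpos)
  refine ⟨y, h1, h2, h3, ?_⟩
  let X : Finset (Fin n) := {u | pairDeg y u = pairDeg (trueWeight μ f) u}
  have hfar := hf (fun e => decide (e.1 ⊆ Xᶜ)) ⟨Xᶜ, fun e => by simp⟩
  have hX : ∑ u ∈ X, pairDeg (trueWeight μ f) u = ∑ u ∈ X, pairDeg y u :=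
    Finset.sum_congr rfl fun u hu => (Finset.mem_filter.1 hu).2.symm
  rw [sum_pairDeg, sum_pairDeg] at hX
  have hle : disagreement μ f (fun e => decide (e.1 ⊆ Xᶜ)) ≤
      ∑ e, (trueWeight μ f e * #(e.1 ∩ X) + y e * (2 - #(e.1 ∩ X))) := by
    unfold disagreement
    refine Finset.sum_le_sum fun e _ => ?_
    have hsub : e.1 ⊆ Xᶜ ↔ e.1 ∩ X = ∅ := by
      rw [Finset.subset_compl_iff_disjoint_right, Finset.disjoint_iff_inter_eq_empty]
    have hy := h1 e
    have hc := card_inter_le_two e X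
    have hyc : 0 ≤ y e * (2 - #(e.1 ∩ X)) := mul_nonneg hy (by linarith)
    cases hfe : f e
    · have hp : trueWeight μ f e = 0 := by simp [trueWeight, hfe]
      rw [hp, zero_mul, zero_add]
      by_cases hs : e.1 ∩ X = ∅
      · have hye : y e = μ e := by
          rcases h4 e with h | ⟨u, hu, h⟩
          · simpa [falseWeight, hfe] using h
          · have : u ∈ e.1 ∩ X := Finset.mem_inter.2 ⟨hu, by simpa [X] using h⟩
            rw [hs] at this; simp at this
        rw [hs, hye]
        have := hμ e
        split_ifs <;> simp <;> linarith
      · have : ¬ e.1 ⊆ Xᶜ := fun h => hs (hsub.1 h)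
        simpa [this] using hyc
    · have hp : trueWeight μ f e = μ e := by simp [trueWeight, hfe]
      rw [hp]
      by_cases hs : e.1 ⊆ Xᶜ
      · rw [if_neg (by simp [hs])]
        have := mul_nonneg (hμ e) (Nat.cast_nonneg (α := ℝ) #(e.1 ∩ X))
        linarith
      · have : (1 : ℝ) ≤ #(e.1 ∩ X) := by
          exact_mod_cast Finset.card_pos.2 (Finset.nonempty_iff_ne_empty.2 fun h => hs (hsub.2 h))
        have := mul_le_mul_of_nonneg_left this (hμ e)
        rw [if_pos (by simp [hs])]
        linarith
  rw [Finset.sum_add_distrib, hX, ← Finset.sum_add_distrib] at hle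
  have : ∑ e, (y e * #(e.1 ∩ X) + y e * (2 - #(e.1 ∩ X))) = 2 * ∑ e, y e := by
    rw [Finset.mul_sum]; exact Finset.sum_congr rfl fun e _ => by ring
  linarith

/-- Maximize the mass inside `W` minus `δ` per vertex: removing one vertex does not help, which
gives the degrees, and comparison with `univ` gives the mass. -/
theorem exists_minDegree_subset {y : VertexPair n → ℝ} {δ : ℝ} :
    ∃ W : Finset (Fin n), (∀ u ∈ W, δ ≤ pairDeg (fun e => if e.1 ⊆ W then y e else 0) u) ∧
      ∑ e, y e - n * δ + #W * δ ≤ ∑ e, if e.1 ⊆ W then y e else 0 := by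
  classical
  let Φ : Finset (Fin n) → ℝ := fun W => (∑ e, if e.1 ⊆ W then y e else 0) - #W * δ
  obtain ⟨W, -, hW⟩ := (univ : Finset (Finset (Fin n))).exists_max_image Φ univ_nonempty
  refine ⟨W, fun u hu => ?_, ?_⟩
  · have h := hW (W.erase u) (mem_univ _)
    have hcard : (#(W.erase u) : ℝ) = #W - 1 := by
      rw [Finset.card_erase_of_mem hu, Nat.cast_pred (Finset.card_pos.2 ⟨u, hu⟩)]
    have hsum : (∑ e : VertexPair n, if e.1 ⊆ W then y e else 0) =
        (∑ e : VertexPair n, if e.1 ⊆ W.erase u then y e else 0) +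
          pairDeg (fun e => if e.1 ⊆ W then y e else 0) u := by
      unfold pairDeg
      rw [← Finset.sum_add_distrib]
      refine Finset.sum_congr rfl fun e _ => ?_
      by_cases hu : u ∈ e.1 <;> by_cases he : e.1 ⊆ W <;> simp [hu, he, Finset.subset_erase]
    simp only [Φ] at h
    rw [hcard, hsum] at h
    linarith
  · have h := hW univ (mem_univ _)
    simp only [Φ, Finset.subset_univ, if_true, Finset.card_univ, Fintype.card_fin] at h
    linarith

end Matching

/-! ### Detecting a violated triple -/

section Detection

variable {n : ℕ}

/-- The vertices of `W` covered by a pair of `R` labeled `true`. -/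
def touched (f : VertexPair n → Bool) (W : Finset (Fin n)) (R : Finset (VertexPair n)) :
    Finset (Fin n) :=
  {u ∈ W | ∃ e ∈ R, f e = true ∧ u ∈ e.1}

/-- The vertices of `W` joined to a touched vertex by a pair of `R` labeled `false`. -/
def linked (f : VertexPair n → Bool) (W : Finset (Fin n)) (R : Finset (VertexPair n)) :
    Finset (Fin n) :=
  {v ∈ W | ∃ e ∈ R, f e = false ∧ v ∈ e.1 ∧ ∃ u ∈ e.1, u ≠ v ∧ u ∈ touched f W R}

/-- Some linked vertex is touched. -/
def Detected (f : VertexPair n → Bool) (W : Finset (Fin n)) (R : Finset (VertexPair n)) : Prop :=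
  ∃ v ∈ linked f W R, v ∈ touched f W R

variable {f : VertexPair n → Bool} {W : Finset (Fin n)} {R R' : Finset (VertexPair n)}

theorem touched_mono (h : R ⊆ R') : touched f W R ⊆ touched f W R' := fun u hu => by
  obtain ⟨hW, e, he, h'⟩ := Finset.mem_filter.1 hu
  exact Finset.mem_filter.2 ⟨hW, e, h he, h'⟩

theorem linked_mono (h : R ⊆ R') : linked f W R ⊆ linked f W R' := fun v hv => by
  obtain ⟨hW, e, he, h1, h2, u, hu, h3, h4⟩ := Finset.mem_filter.1 hv
  exact Finset.mem_filter.2 ⟨hW, e, h he, h1, h2, u, hu, h3, touched_mono h h4⟩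

theorem Detected.mono (h : R ⊆ R') (hR : Detected f W R) : Detected f W R' :=
  let ⟨v, h1, h2⟩ := hR
  ⟨v, linked_mono h h1, touched_mono h h2⟩

theorem min_sum_mono {V : Type} [DecidableEq V] {c : V → ℝ} {X Y : Finset V} {M : ℝ}
    (hc : ∀ u ∈ Y, 0 ≤ c u) (h : X ⊆ Y) : min (∑ u ∈ X, c u) M ≤ min (∑ u ∈ Y, c u) M :=
  min_le_min_right _ (Finset.sum_le_sum_of_subset_of_nonneg h fun u hu _ => hc u hu)

/-- The cap is `a + δ` rather than `a` so that a full increment `δ` still counts when the sum is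
just at `a`. -/
theorem min_sum_add_le {V : Type} [DecidableEq V] {c : V → ℝ} {X Y : Finset V} {a δ : ℝ}
    (hc : ∀ u ∈ Y, 0 ≤ c u) (h : X ⊆ Y) {v : V} (hv : v ∈ Y) (hvX : v ∉ X) (hδ : δ ≤ c v)
    (hX : ∑ u ∈ X, c u ≤ a) :
    min (∑ u ∈ X, c u) (a + δ) + δ ≤ min (∑ u ∈ Y, c u) (a + δ) := by
  have h1 : ∑ u ∈ insert v X, c u ≤ ∑ u ∈ Y, c u :=
    Finset.sum_le_sum_of_subset_of_nonneg (Finset.insert_subset hv h) fun u hu _ => hc u hu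
  rw [Finset.sum_insert hvX] at h1
  refine le_min ?_ ?_
  · linarith [min_le_left (∑ u ∈ X, c u) (a + δ)]
  · linarith [min_le_left (∑ u ∈ X, c u) (a + δ)]

/-- A fractional matching of negative pairs, dominated by the positive pairs at each vertex and of
minimum degree `δ` on `W`. -/
structure DominatedMatching (μ : VertexPair n → ℝ) (f : VertexPair n → Bool) (W : Finset (Fin n))
    (y : VertexPair n → ℝ) (δ : ℝ) : Prop where
  nonneg : ∀ e, 0 ≤ y e
  le_falseWeight : ∀ e, y e ≤ falseWeight μ f e
  subset : ∀ e, y e ≠ 0 → e.1 ⊆ W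
  deg_le : ∀ u, pairDeg y u ≤ pairDeg (trueWeight μ f) u
  le_deg : ∀ u ∈ W, δ ≤ pairDeg y u

variable {μ y : VertexPair n → ℝ} {δ : ℝ}

theorem trueWeight_nonneg (hμ : ∀ e, 0 ≤ μ e) (e : VertexPair n) : 0 ≤ trueWeight μ f e := by
  unfold trueWeight; split_ifs; exacts [hμ e, le_rfl]

theorem exists_dominatedMatching (hμ : ∀ e, 0 ≤ μ e) {ε : ℝ}
    (hf : ∀ g ∈ cliqueProperty n, ε ≤ disagreement μ f g) (hδ0 : 0 ≤ δ) (hδ : n * δ ≤ ε / 4) :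
    ∃ W y, DominatedMatching μ f W y δ ∧ ε / 4 ≤ ∑ e, y e := by
  obtain ⟨y, h1, h2, h3, h4⟩ := exists_matching_of_far hμ hf
  obtain ⟨W, hW, hsum⟩ := exists_minDegree_subset (y := y) (δ := δ)
  have hle : ∀ e, (if e.1 ⊆ W then y e else 0) ≤ y e := fun e => by
    split_ifs; exacts [le_rfl, h1 e]
  refine ⟨W, fun e => if e.1 ⊆ W then y e else 0, ⟨fun e => ?_, fun e => (hle e).trans (h2 e),
    fun e he => ?_, fun u => ?_, hW⟩, ?_⟩
  · split_ifs; exacts [h1 e, le_rfl]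
  · by_contra h; simp [h] at he
  · refine le_trans (Finset.sum_le_sum fun e _ => ?_) (h3 u)
    split_ifs
    exacts [hle e, le_rfl]
  · have : 0 ≤ #W * δ := by positivity
    linarith

theorem DominatedMatching.sum_deg (h : DominatedMatching μ f W y δ) :
    ∑ u ∈ W, pairDeg y u = 2 * ∑ e, y e := by
  rw [sum_pairDeg, Finset.mul_sum]
  refine Finset.sum_congr rfl fun e _ => ?_
  by_cases hy : y e = 0
  · simp [hy]
  · rw [Finset.inter_eq_left.2 (h.subset e hy), e.2]; push_cast; ring

theorem sum_trueWeight_le (hμ : ∀ e, 0 ≤ μ e) (G : Finset (VertexPair n)) :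
    ∑ e ∈ G, trueWeight μ f e ≤ ∑ e ∈ G, μ e :=
  Finset.sum_le_sum fun e _ => by unfold trueWeight; split_ifs; exacts [le_rfl, hμ e]

/-- The positive pairs meeting a vertex set. -/
def posMeeting (f : VertexPair n → Bool) (X : Finset (Fin n)) : Finset (VertexPair n) :=
  {e | f e = true ∧ ∃ u ∈ e.1, u ∈ X}

theorem sum_deg_le_posMeeting (hμ : ∀ e, 0 ≤ μ e) (X : Finset (Fin n)) :
    ∑ u ∈ X, pairDeg (trueWeight μ f) u ≤ 2 * ∑ e ∈ posMeeting f X, μ e := by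
  refine (sum_pairDeg_le (trueWeight_nonneg hμ) (G := posMeeting f X) fun e he u hu hX => ?_).trans
    (mul_le_mul_of_nonneg_left (sum_trueWeight_le hμ _) zero_le_two)
  refine Finset.mem_filter.2 ⟨Finset.mem_univ _, ?_, u, hu, hX⟩
  by_contra h
  simp [trueWeight, h] at he

/-- The negative pairs inside `W` from `U` to the complement of `V`. -/
def negLeaving (f : VertexPair n → Bool) (W U V : Finset (Fin n)) : Finset (VertexPair n) :=
  {e | f e = false ∧ ∃ u ∈ e.1, ∃ v ∈ e.1, u ≠ v ∧ u ∈ U ∧ v ∈ W ∧ v ∉ V}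

/-- For a pair in the support of `y` that is not in `negLeaving`, an endpoint in `U` forces the
other into `V`; such a pair therefore meets `V` at least as often as `U`. -/
theorem DominatedMatching.sum_deg_le_negLeaving (h : DominatedMatching μ f W y δ)
    (U V : Finset (Fin n)) :
    ∑ u ∈ U, pairDeg y u ≤ 2 * ∑ e ∈ negLeaving f W U V, μ e + ∑ v ∈ V, pairDeg y v := by
  classical
  have hy : ∀ e ∈ negLeaving f W U V, y e ≤ μ e := fun e he => by
    have := h.le_falseWeight e
    rwa [falseWeight, (Finset.mem_filter.1 he).2.1, if_neg (by simp)] at this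
  have key : ∑ u ∈ U, pairDeg y u ≤
      2 * ∑ e ∈ negLeaving f W U V, y e + ∑ v ∈ V, pairDeg y v := by
    rw [sum_pairDeg, sum_pairDeg, Finset.mul_sum,
      ← Finset.sum_filter_add_sum_filter_not univ (· ∈ negLeaving f W U V)
        (fun e => y e * (#(e.1 ∩ U) : ℝ)),
      ← Finset.sum_filter_add_sum_filter_not univ (· ∈ negLeaving f W U V)
        (fun e => y e * (#(e.1 ∩ V) : ℝ)), Finset.filter_mem_eq_inter, Finset.univ_inter, ← add_assoc]
    refine add_le_add ?_ ?_
    · rw [← Finset.sum_add_distrib]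
      refine Finset.sum_le_sum fun e _ => ?_
      have := mul_le_mul_of_nonneg_left (card_inter_le_two e U) (h.nonneg e)
      have := mul_nonneg (h.nonneg e) (Nat.cast_nonneg (α := ℝ) #(e.1 ∩ V))
      linarith
    · refine Finset.sum_le_sum fun e he => ?_
      by_cases hye : y e = 0
      · simp [hye]
      refine mul_le_mul_of_nonneg_left ?_ (h.nonneg e)
      have hfe : f e = false := by
        by_contra hfe
        have := h.le_falseWeight e
        rw [falseWeight, if_pos (by simpa using hfe)] at this
        exact hye (le_antisymm this (h.nonneg e))
      have hW := h.subset e hye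
      have hnot : ∀ u ∈ e.1, ∀ v ∈ e.1, u ≠ v → u ∈ U → v ∈ V := by
        intro u hu v hv huv hU
        by_contra hV
        exact (Finset.mem_filter.1 he).2
          (Finset.mem_filter.2 ⟨Finset.mem_univ _, hfe, u, hu, v, hv, huv, hU, hW hv, hV⟩)
      obtain ⟨a, b, hab, hE⟩ := Finset.card_eq_two.1 e.2
      rw [hE] at hnot ⊢
      have h1 := hnot a (by simp) b (by simp) hab
      have h2 := hnot b (by simp) a (by simp) hab.symm
      have hbound : #(({a, b} : Finset (Fin n)) ∩ U) ≤ #(({a, b} : Finset (Fin n)) ∩ V) := by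
        by_cases hA : a ∈ U <;> by_cases hB : b ∈ U
        · rw [Finset.inter_eq_left.2 (by grind : ({a, b} : Finset (Fin n)) ⊆ V)]
          exact Finset.card_le_card Finset.inter_subset_left
        · have hU : ({a, b} : Finset (Fin n)) ∩ U = {a} := by grind
          rw [hU, Finset.card_singleton]
          exact Finset.card_pos.2 ⟨b, by simp [h1 hA]⟩
        · have hU : ({a, b} : Finset (Fin n)) ∩ U = {b} := by grind
          rw [hU, Finset.card_singleton]
          exact Finset.card_pos.2 ⟨a, by simp [h2 hB]⟩
        · have hU : ({a, b} : Finset (Fin n)) ∩ U = ∅ := by grind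
          rw [hU]; simp
      exact_mod_cast hbound
  have := Finset.sum_le_sum hy
  linarith

open Classical in
/-- The potential measuring the progress of `R` towards detection. -/
noncomputable def potential (μ : VertexPair n → ℝ) (f : VertexPair n → Bool) (W : Finset (Fin n))
    (y : VertexPair n → ℝ) (a b c₁ c₂ c₃ δ : ℝ) (R : Finset (VertexPair n)) : ℝ :=
  c₁ * min (∑ u ∈ touched f W R, pairDeg y u) (a + δ) +
    c₂ * min (∑ v ∈ linked f W R, pairDeg (trueWeight μ f) v) (b + δ) +
    c₃ * if Detected f W R then 1 else 0

section

variable {a b c₁ c₂ c₃ : ℝ}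

theorem ite_detected_mono [DecidablePred (Detected f W)] (h : R ⊆ R') :
    (if Detected f W R then (1 : ℝ) else 0) ≤ if Detected f W R' then 1 else 0 := by
  by_cases hR : Detected f W R
  · simp [hR, hR.mono h]
  · rw [if_neg hR]; split_ifs <;> norm_num

theorem potential_mono (hμ : ∀ e, 0 ≤ μ e) (hy : ∀ e, 0 ≤ y e) (hc₁ : 0 ≤ c₁) (hc₂ : 0 ≤ c₂)
    (hc₃ : 0 ≤ c₃) (h : R ⊆ R') :
    potential μ f W y a b c₁ c₂ c₃ δ R ≤ potential μ f W y a b c₁ c₂ c₃ δ R' := by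
  classical
  unfold potential
  gcongr ?_ + ?_ + ?_
  · exact mul_le_mul_of_nonneg_left
      (min_sum_mono (fun u _ => pairDeg_nonneg hy u) (touched_mono h)) hc₁
  · exact mul_le_mul_of_nonneg_left
      (min_sum_mono (fun u _ => pairDeg_nonneg (trueWeight_nonneg hμ) u) (linked_mono h)) hc₂
  · exact mul_le_mul_of_nonneg_left (ite_detected_mono h) hc₃

/-- The case split is by stage, with `h₁`, `h₂`, `h₃` saying that gain times probability of progress
is at least `1`. Domination of `y` by the positive degree is what lets `y`-mass bound the chance of
touching a new vertex, and lets linked vertices be weighed by positive degree. -/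
theorem DominatedMatching.potential_step (h : DominatedMatching μ f W y δ)
    (hμ : μ ∈ stdSimplex ℝ (VertexPair n)) (hδ : 0 < δ)
    (hc₁ : 0 ≤ c₁) (hc₂ : 0 ≤ c₂) (hc₃ : 0 ≤ c₃)
    (h₁ : 1 ≤ c₁ * δ * (∑ e, y e - a / 2)) (h₂ : 1 ≤ c₂ * δ * ((a - b) / 2))
    (h₃ : 1 ≤ c₃ * (b / 2)) (hR : ¬ Detected f W R) :
    potential μ f W y a b c₁ c₂ c₃ δ R + 1 ≤
      ∑ x, μ x * potential μ f W y a b c₁ c₂ c₃ δ (insert x R) := by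
  classical
  have hmono : ∀ R R' : Finset (VertexPair n), R ⊆ R' →
      potential μ f W y a b c₁ c₂ c₃ δ R ≤ potential μ f W y a b c₁ c₂ c₃ δ R' := fun R R' hRR' =>
    potential_mono hμ.1 h.nonneg hc₁ hc₂ hc₃ hRR'
  have hy0 : ∀ u, 0 ≤ pairDeg y u := pairDeg_nonneg h.nonneg
  have hd0 : ∀ u, 0 ≤ pairDeg (trueWeight μ f) u := pairDeg_nonneg (trueWeight_nonneg hμ.1)
  have hU : ∀ x : VertexPair n, touched f W R ⊆ touched f W (insert x R) := fun x =>
    touched_mono (Finset.subset_insert x R)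
  have hV : ∀ x : VertexPair n, linked f W R ⊆ linked f W (insert x R) := fun x =>
    linked_mono (Finset.subset_insert x R)
  have m₁ := fun x => mul_le_mul_of_nonneg_left
    (min_sum_mono (M := a + δ) (fun u _ => hy0 u) (hU x)) hc₁
  have m₂ := fun x => mul_le_mul_of_nonneg_left
    (min_sum_mono (M := b + δ) (fun u _ => hd0 u) (hV x)) hc₂
  have m₃ := fun x => mul_le_mul_of_nonneg_left
    (ite_detected_mono (f := f) (W := W) (Finset.subset_insert x R)) hc₃
  by_cases ha : ∑ u ∈ touched f W R, pairDeg y u ≤ a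
  · refine add_one_le_sum_insert hμ hmono (G := posMeeting f (W \ touched f W R))
      (η := c₁ * δ) (by positivity) h₁ ?_ fun x hx => ?_
    · have e1 := sum_deg_le_posMeeting (f := f) hμ.1 (W \ touched f W R)
      have e2 : ∑ u ∈ W \ touched f W R, pairDeg y u ≤
          ∑ u ∈ W \ touched f W R, pairDeg (trueWeight μ f) u :=
        Finset.sum_le_sum fun u _ => h.deg_le u
      have hsub : touched f W R ⊆ W := Finset.filter_subset _ W
      have e3 := Finset.sum_sdiff (f := pairDeg y) hsub
      have e4 := h.sum_deg
      linarith
    · obtain ⟨hfx, u, hux, hu⟩ := (Finset.mem_filter.1 hx).2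
      obtain ⟨huW, huU⟩ := Finset.mem_sdiff.1 hu
      have hmem : u ∈ touched f W (insert x R) :=
        Finset.mem_filter.2 ⟨huW, x, Finset.mem_insert_self _ _, hfx, hux⟩
      have := mul_le_mul_of_nonneg_left
        (min_sum_add_le (fun u _ => hy0 u) (hU x) hmem huU (h.le_deg u huW) ha) hc₁
      have := m₂ x
      have := m₃ x
      unfold potential
      linarith
  by_cases hb : ∑ v ∈ linked f W R, pairDeg (trueWeight μ f) v ≤ b
  · refine add_one_le_sum_insert hμ hmono
      (G := negLeaving f W (touched f W R) (linked f W R))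
      (η := c₂ * δ) (by positivity) h₂ ?_ fun x hx => ?_
    · have e1 := h.sum_deg_le_negLeaving (touched f W R) (linked f W R)
      have e2 : ∑ u ∈ linked f W R, pairDeg y u ≤
          ∑ u ∈ linked f W R, pairDeg (trueWeight μ f) u :=
        Finset.sum_le_sum fun u _ => h.deg_le u
      push Not at ha
      linarith
    · obtain ⟨hfx, u, hux, v, hvx, huv, hu, hvW, hv⟩ := (Finset.mem_filter.1 hx).2
      have hmem : v ∈ linked f W (insert x R) :=
        Finset.mem_filter.2 ⟨hvW, x, Finset.mem_insert_self _ _, hfx, hvx, u, hux, huv, hU x hu⟩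
      have := mul_le_mul_of_nonneg_left
        (min_sum_add_le (fun u _ => hd0 u) (hV x) hmem hv
          ((h.le_deg v hvW).trans (h.deg_le v)) hb) hc₂
      have := m₁ x
      have := m₃ x
      unfold potential
      linarith
  · refine add_one_le_sum_insert hμ hmono (G := posMeeting f (linked f W R))
      (η := c₃) hc₃ h₃ ?_ fun x hx => ?_
    · have e1 := sum_deg_le_posMeeting (f := f) hμ.1 (linked f W R)
      push Not at hb
      linarith
    · obtain ⟨hfx, v, hvx, hv⟩ := (Finset.mem_filter.1 hx).2
      have hmem : v ∈ touched f W (insert x R) :=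
        Finset.mem_filter.2 ⟨(Finset.mem_filter.1 hv).1, x, Finset.mem_insert_self _ _, hfx, hvx⟩
      have hdet : Detected f W (insert x R) := ⟨v, hV x hv, hmem⟩
      have := m₁ x
      have := m₂ x
      unfold potential
      rw [if_pos hdet, if_neg hR]
      linarith

open Classical in
theorem DominatedMatching.miss_prob_le (h : DominatedMatching μ f W y δ)
    (hμ : μ ∈ stdSimplex ℝ (VertexPair n)) (hδ : 0 < δ) (ha : 0 ≤ a) (hb : 0 ≤ b)
    (hc₁ : 0 ≤ c₁) (hc₂ : 0 ≤ c₂) (hc₃ : 0 ≤ c₃)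
    (h₁ : 1 ≤ c₁ * δ * (∑ e, y e - a / 2)) (h₂ : 1 ≤ c₂ * δ * ((a - b) / 2))
    (h₃ : 1 ≤ c₃ * (b / 2)) (m : ℕ) :
    m * ∑ x : Fin m → VertexPair n,
        (∏ i, μ (x i)) * (if Detected f W (univ.image x) then 0 else 1) ≤
      c₁ * (a + δ) + c₂ * (b + δ) + c₃ := by
  have key := _root_.miss_prob_le hμ (good := Detected f W) (fun _ _ hR h => h.mono hR)
    (φ := potential μ f W y a b c₁ c₂ c₃ δ) (K := c₁ * (a + δ) + c₂ * (b + δ) + c₃)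
    (fun R => by
      unfold potential
      have := mul_le_mul_of_nonneg_left
        (min_le_right (∑ u ∈ touched f W R, pairDeg y u) (a + δ)) hc₁
      have := mul_le_mul_of_nonneg_left
        (min_le_right (∑ v ∈ linked f W R, pairDeg (trueWeight μ f) v) (b + δ)) hc₂
      split_ifs <;> linarith)
    (fun R hR => h.potential_step hμ hδ hc₁ hc₂ hc₃ h₁ h₂ h₃ hR) m ∅
  simp only [Finset.empty_union] at key
  have h0 : 0 ≤ potential μ f W y a b c₁ c₂ c₃ δ ∅ := by
    unfold potential
    have e1 : 0 ≤ min (∑ u ∈ touched f W ∅, pairDeg y u) (a + δ) :=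
      le_min (Finset.sum_nonneg fun u _ => pairDeg_nonneg h.nonneg u) (by linarith)
    have e2 : 0 ≤ min (∑ v ∈ linked f W ∅, pairDeg (trueWeight μ f) v) (b + δ) :=
      le_min (Finset.sum_nonneg fun u _ => pairDeg_nonneg (trueWeight_nonneg hμ.1) u) (by linarith)
    have e3 : (0 : ℝ) ≤ if Detected f W ∅ then 1 else 0 := by split_ifs <;> norm_num
    exact add_nonneg (add_nonneg (mul_nonneg hc₁ e1) (mul_nonneg hc₂ e2)) (mul_nonneg hc₃ e3)
  linarith

end

end Detection

/-! ### The tester -/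

section CliqueTester

variable {n m : ℕ}

/-- The samples contain a negative pair and positive pairs at both of its vertices. -/
def SeesViolation (s : Fin m → VertexPair n × Bool) : Prop :=
  ∃ i, (s i).2 = false ∧ ∀ u ∈ (s i).1.1, ∃ j, (s j).2 = true ∧ u ∈ (s j).1.1

open Classical in
/-- The tester that rejects exactly when it sees a violation. -/
noncomputable def cliqueTester (n m : ℕ) : Tester (VertexPair n) m := fun s =>
  ⟨Pi.single (!decide (SeesViolation s)) 1, single_mem_stdSimplex ℝ _⟩

theorem not_seesViolation {f : VertexPair n → Bool} (hf : f ∈ cliqueProperty n)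
    (x : Fin m → VertexPair n) : ¬ SeesViolation fun i => (x i, f (x i)) := by
  rintro ⟨i, hi, h⟩
  obtain ⟨S, hS⟩ := hf
  refine Bool.false_ne_true (hi.symm.trans ((hS _).2 fun u hu => ?_))
  obtain ⟨j, hj, huj⟩ := h u hu
  exact (hS _).1 hj huj

theorem Detected.seesViolation {f : VertexPair n → Bool} {W : Finset (Fin n)}
    {x : Fin m → VertexPair n} (h : Detected f W (univ.image x)) :
    SeesViolation fun i => (x i, f (x i)) := by
  have htouch : ∀ u ∈ touched f W (univ.image x), ∃ j, f (x j) = true ∧ u ∈ (x j).1 := by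
    intro u hu
    obtain ⟨-, e, he, h⟩ := Finset.mem_filter.1 hu
    obtain ⟨j, -, rfl⟩ := Finset.mem_image.1 he
    exact ⟨j, h⟩
  obtain ⟨v, hv, hvU⟩ := h
  obtain ⟨-, e, he, hfe, hve, u, hue, huv, huU⟩ := Finset.mem_filter.1 hv
  obtain ⟨i, -, rfl⟩ := Finset.mem_image.1 he
  refine ⟨i, hfe, fun w hw => ?_⟩
  have hE : ({u, v} : Finset (Fin n)) = (x i).1 :=
    Finset.eq_of_subset_of_card_le (by grind) (by rw [Finset.card_pair huv, (x i).2])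
  dsimp only at hw
  rw [← hE, Finset.mem_insert, Finset.mem_singleton] at hw
  rcases hw with rfl | rfl
  exacts [htouch _ huU, htouch _ hvU]

theorem isTester_cliqueTester (hn : 1 ≤ n) {ε : ℝ} (hε : 0 < ε)
    (hm : 168 * ((n : ℝ) ^ ((2 : ℝ) / 3) / ε) ≤ m) :
    IsTester (cliqueTester n m) (cliqueProperty n) ε := by
  classical
  intro μ hμ f
  refine ⟨fun hf => ?_, fun hf => ?_⟩
  · have : answerProb (cliqueTester n m) μ f true = 1 := by
      rw [← sum_prod_eq_one (m := m) hμ]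
      refine Finset.sum_congr rfl fun x _ => ?_
      simp [cliqueTester, not_seesViolation hf x]
    rw [this]; norm_num
  · have hn0 : (0 : ℝ) < n := by exact_mod_cast hn
    set t : ℝ := (n : ℝ) ^ ((1 : ℝ) / 3) with ht
    have ht1 : 1 ≤ t := Real.one_le_rpow (by exact_mod_cast hn) (by norm_num)
    have ht0 : 0 < t := by linarith
    have ht3 : t ^ 3 = n := by
      rw [ht, ← Real.rpow_natCast, ← Real.rpow_mul hn0.le]; norm_num
    have ht2 : (n : ℝ) ^ ((2 : ℝ) / 3) = t ^ 2 := by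
      rw [ht, ← Real.rpow_natCast, ← Real.rpow_mul hn0.le]; norm_num
    rw [ht2] at hm
    obtain ⟨W, y, h, hy⟩ := exists_dominatedMatching (δ := ε / (4 * t ^ 3)) hμ.1 hf
      (by positivity) (by rw [← ht3]; apply le_of_eq; field_simp)
    have hA : ε / (4 * t) ≤ ε / 4 := div_le_div_of_nonneg_left hε.le (by norm_num) (by linarith)
    -- The thresholds balance the three stages at order `t ^ 2 / ε`; each `cᵢ` is of the order of
    -- the inverse of gain times probability in its stage.
    have key := h.miss_prob_le (a := ε / (4 * t)) (b := ε / (8 * t ^ 2)) (c₁ := 32 * t ^ 3 / ε ^ 2)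
      (c₂ := 64 * t ^ 4 / ε ^ 2) (c₃ := 16 * t ^ 2 / ε) hμ (by positivity) (by positivity)
      (by positivity) (by positivity) (by positivity) (by positivity)
      (by
        have e : 32 * t ^ 3 / ε ^ 2 * (ε / (4 * t ^ 3)) = 8 / ε := by field_simp; norm_num
        rw [e, div_mul_eq_mul_div, le_div_iff₀ hε]
        linarith)
      (by
        have e : 64 * t ^ 4 / ε ^ 2 * (ε / (4 * t ^ 3)) *
            ((ε / (4 * t) - ε / (8 * t ^ 2)) / 2) = 2 - 1 / t := by field_simp; ring
        rw [e]
        have : 1 / t ≤ 1 := (div_le_one ht0).2 ht1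
        linarith)
      (le_of_eq (by field_simp; norm_num)) m
    have hK : 32 * t ^ 3 / ε ^ 2 * (ε / (4 * t) + ε / (4 * t ^ 3)) +
        64 * t ^ 4 / ε ^ 2 * (ε / (8 * t ^ 2) + ε / (4 * t ^ 3)) + 16 * t ^ 2 / ε ≤
        56 * (t ^ 2 / ε) := by
      have e : 32 * t ^ 3 / ε ^ 2 * (ε / (4 * t) + ε / (4 * t ^ 3)) +
        64 * t ^ 4 / ε ^ 2 * (ε / (8 * t ^ 2) + ε / (4 * t ^ 3)) + 16 * t ^ 2 / ε =
          (32 * t ^ 2 + 8 + 16 * t) / ε := by field_simp; ring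
      rw [e, ← mul_div_assoc]
      gcongr
      nlinarith
    have hprob : ∑ x : Fin m → VertexPair n, ∏ i, μ (x i) - ∑ x : Fin m → VertexPair n,
        (∏ i, μ (x i)) * (if Detected f W (univ.image x) then 0 else 1) ≤
        answerProb (cliqueTester n m) μ f false := by
      rw [← Finset.sum_sub_distrib]
      refine Finset.sum_le_sum fun x _ => ?_
      have hp : 0 ≤ ∏ i, μ (x i) := Finset.prod_nonneg fun i _ => hμ.1 _
      by_cases hd : Detected f W (univ.image x)
      · simp [hd, cliqueTester, hd.seesViolation]
      · simp only [hd, if_false, mul_one, sub_self]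
        exact mul_nonneg hp ((cliqueTester n m _).2.1 false)
    rw [sum_prod_eq_one hμ] at hprob
    have hpos : 0 < t ^ 2 / ε := by positivity
    set q := ∑ x : Fin m → VertexPair n,
        (∏ i, μ (x i)) * (if Detected f W (univ.image x) then (0 : ℝ) else 1)
    -- Here `168 = 3 * 56`.
    have hq : q ≤ 1 / 3 := by
      by_contra! hq
      nlinarith
    linarith

end CliqueTester

theorem theorem4 :
    ∃ c C : ℝ, 0 < c ∧ 0 < C ∧ ∀ n : ℕ, 1 ≤ n → ∀ ε : ℝ, 0 < ε → ε < 1 / 10 →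
      (sufficientSampleSizes (cliqueProperty n) ε).Nonempty ∧
      c * (n : ℝ) ^ ((2 : ℝ) / 3) ≤ (sam (cliqueProperty n) ε : ℝ) ∧
      (sam (cliqueProperty n) ε : ℝ) ≤ C * ((n : ℝ) ^ ((2 : ℝ) / 3) / ε) := by
  refine ⟨1 / 10, 169, by norm_num, by norm_num, fun n hn ε hε hε' => ?_⟩
  set r : ℝ := (n : ℝ) ^ ((2 : ℝ) / 3) / ε with hr
  have hr1 : 1 ≤ r := by
    rw [hr, le_div_iff₀ hε]
    have : (1 : ℝ) ≤ (n : ℝ) ^ ((2 : ℝ) / 3) :=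
      Real.one_le_rpow (by exact_mod_cast hn) (by norm_num)
    linarith
  have hmem : ⌈168 * r⌉₊ ∈ sufficientSampleSizes (cliqueProperty n) ε :=
    ⟨Nat.ceil_pos.2 (by linarith), cliqueTester n _,
      isTester_cliqueTester hn hε (Nat.le_ceil _)⟩
  refine ⟨⟨_, hmem⟩, ?_, ?_⟩
  · obtain ⟨hpos, A, hA⟩ := Nat.sInf_mem ⟨_, hmem⟩
    exact rpow_le_of_isTester hn hpos (by linarith) hA
  · have h1 : (sam (cliqueProperty n) ε : ℝ) ≤ ⌈168 * r⌉₊ := by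
      exact_mod_cast Nat.sInf_le hmem
    -- Since `1 ≤ r`, rounding up is absorbed by passing from `168` to `169`.
    have h2 := Nat.ceil_lt_add_one (a := 168 * r) (by linarith)
    linarith
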